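/- Let $k$ be a field of characteristic $0$. Let $(U,\mu,\partial)$ be a differential graded associative (not necessarily unital) $k$-algebra: $U=\bigoplus_{i\in\mathbb Z}U_i$ is a graded $k$-vector space, $\partial:U\to U$ is linear of degree $-1$ with $\partial^2=0$, and $\mu:U\otimes U\to U$ is linear of degree $0$, associative, and satisfies $\partial\mu(a,b)=\mu(\partial a,b)+(-1)^{|a|}\mu(a,\partial b)$. Let $\nu:U\otimes U\to U$ be a bilinear multiplication chain homotopic to $\mu$, that is, there is a linear map $h:U\otimes U\to U$ of degree $1$ with $$\nu(a,b)-\mu(a,b)=\partial h(a,b)+h(\partial a,b)+(-1)^{|a|}h(a,\partial b)$$ for all homogeneous $a,b\in U$. Then $\nu$ extends to a strongly homotopy associative ($A(\infty)$) structure on $(U,\partial)$: there are linear maps $m_n:U^{\otimes n}\to U$ of degree $n-2$, $n\ge 2$, with $m_2=\nu$, such that for every $n\ge 2$ $$\partial m_n-(-1)^{n}\sum_{s=0}^{n-1}m_n\bigl(1^{\otimes s}\otimes\partial\otimes 1^{\otimes (n-s-1)}\bigr)=\sum_{\substack{i+j=n+1\\ i,j\ge 2}}\ \sum_{s=0}^{n-j}(-1)^{i+s(j+1)}\,m_i\bigl(1^{\otimes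 s}\otimes m_j\otimes 1^{\otimes (i-s-1)}\bigr),$$ where tensor products of maps are evaluated with the Koszul sign rule. -/

import Mathlib

namespace HomotopyAlg

variable {k : Type*} [Field k] {U : Type*} [AddCommGroup U] [Module k U]

/-- `(U, d)` is a chain complex: `U` is the internal direct sum of its homogeneous parts `𝒰 i`,
`i : ℤ`, and `d` is a linear map of degree `-1` with `d ∘ d = 0`. -/
structure IsChainComplex (𝒰 : ℤ → Submodule k U) (d : U →ₗ[k] U) : Prop where
  internal : DirectSum.IsInternal 𝒰
  degree : ∀ (i : ℤ) (a : U), a ∈ 𝒰 i → d a ∈ 𝒰 (i - 1)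
  square : ∀ a : U, d (d a) = 0

/-- The bilinear map `φ`, seen as a map `U ⊗ U → U`, is homogeneous of degree `e`. -/
def IsBilinOfDegree (𝒰 : ℤ → Submodule k U) (e : ℤ) (φ : U →ₗ[k] U →ₗ[k] U) : Prop :=
  ∀ (i j : ℤ) (a b : U), a ∈ 𝒰 i → b ∈ 𝒰 j → φ a b ∈ 𝒰 (i + j + e)

/-- `(U, μ, d)` is a differential graded associative (not necessarily unital) algebra. -/
structure IsDGAssociative (𝒰 : ℤ → Submodule k U) (d : U →ₗ[k] U)
    (μ : U →ₗ[k] U →ₗ[k] U) : Prop where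
  complex : IsChainComplex 𝒰 d
  degree : IsBilinOfDegree 𝒰 0 μ
  leibniz : ∀ (i : ℤ) (a b : U), a ∈ 𝒰 i → d (μ a b) = μ (d a) b + i.negOnePow • μ a (d b)
  assoc : ∀ a b c : U, μ (μ a b) c = μ a (μ b c)

/-- `ν` is chain homotopic to `μ`, both seen as maps of complexes `U ⊗ U → U`: there is a map
`h : U ⊗ U → U` of degree `1` with `ν - μ = d h + h d_{U ⊗ U}`, where
`d_{U ⊗ U} (a ⊗ b) = d a ⊗ b + (-1)^{|a|} a ⊗ d b`. If `μ` is a chain map of degree `0`, then this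
makes `ν` one as well. -/
def ChainHomotopic (𝒰 : ℤ → Submodule k U) (d : U →ₗ[k] U) (ν μ : U →ₗ[k] U →ₗ[k] U) : Prop :=
  ∃ h : U →ₗ[k] U →ₗ[k] U, IsBilinOfDegree 𝒰 1 h ∧
    ∀ (i : ℤ) (a b : U), a ∈ 𝒰 i →
      ν a b - μ a b = d (h a b) + (h (d a) b + i.negOnePow • h a (d b))

/-! Multilinear maps in `n` variables are evaluated on the first `n` terms `a 0, …, a (n - 1)` of
a sequence `a : ℕ → U`, where `a r` is homogeneous of degree `g r`. -/

/-- The `n`-linear map `φ`, seen as a map `U^{⊗ n} → U`, is homogeneous of degree `e`. -/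
def IsMultilinOfDegree (𝒰 : ℤ → Submodule k U) (e : ℤ) {n : ℕ}
    (φ : MultilinearMap k (fun _ : Fin n => U) U) : Prop :=
  ∀ (g : ℕ → ℤ) (a : ℕ → U), (∀ r, a r ∈ 𝒰 (g r)) →
    φ (fun r : Fin n => a r) ∈ 𝒰 ((∑ r ∈ Finset.range n, g r) + e)

/-- The differential `d φ - (-1)^e φ d_{U^{⊗ n}}` of a map `φ` of degree `e` in the complex
`Hom(U^{⊗ n}, U)`, evaluated at `a 0 ⊗ ⋯ ⊗ a (n - 1)`. -/
def homDiff (d : U →ₗ[k] U) (e : ℤ) {n : ℕ} (φ : MultilinearMap k (fun _ : Fin n => U) U)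
    (g : ℕ → ℤ) (a : ℕ → U) : U :=
  d (φ (fun r : Fin n => a r)) -
    e.negOnePow • ∑ s ∈ Finset.range n,
      (∑ r ∈ Finset.range s, g r).negOnePow •
        φ (fun r : Fin n => if (r : ℕ) = s then d (a r) else a r)

/-- The composition `φ (1^{⊗ s} ⊗ ψ ⊗ 1^{⊗ (i - s - 1)})`, `0 ≤ s < i`, of an `i`-linear map `φ`
and a `j`-linear map `ψ` of degree `e`, evaluated at `a 0 ⊗ ⋯ ⊗ a (i + j - 2)`. Moving `ψ` past
the first `s` arguments produces the Koszul sign. -/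
def insertOp {i j : ℕ} (φ : MultilinearMap k (fun _ : Fin i => U) U) (e : ℤ)
    (ψ : MultilinearMap k (fun _ : Fin j => U) U) (s : ℕ) (g : ℕ → ℤ) (a : ℕ → U) : U :=
  (e * ∑ r ∈ Finset.range s, g r).negOnePow •
    φ (fun r : Fin i =>
      if (r : ℕ) < s then a r
      else if (r : ℕ) = s then ψ (fun t : Fin j => a (s + t))
      else a (r + j - 1))

/-- `(U, d, m 2, m 3, …)` is a strongly homotopy associative algebra (an `A(∞)`-algebra): for
`n ≥ 2`, the operation `m n : U^{⊗ n} → U` has degree `n - 2` and its differential in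
`Hom(U^{⊗ n}, U)` is
`∑_{i + j = n + 1, i, j ≥ 2} ∑_{0 ≤ s ≤ n - j} (-1)^{i + s (j + 1)}
  m i (1^{⊗ s} ⊗ m j ⊗ 1^{⊗ (i - s - 1)})`.
The components `m 0` and `m 1` are not part of the structure; nothing refers to them. -/
structure IsAInfinity (𝒰 : ℤ → Submodule k U) (d : U →ₗ[k] U)
    (m : (n : ℕ) → MultilinearMap k (fun _ : Fin n => U) U) : Prop where
  complex : IsChainComplex 𝒰 d
  degree : ∀ n : ℕ, 2 ≤ n → IsMultilinOfDegree 𝒰 ((n : ℤ) - 2) (m n)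
  relation : ∀ n : ℕ, 2 ≤ n → ∀ (g : ℕ → ℤ) (a : ℕ → U), (∀ r, a r ∈ 𝒰 (g r)) →
    homDiff d ((n : ℤ) - 2) (m n) g a =
      ∑ p ∈ (Finset.HasAntidiagonal.antidiagonal (n + 1)).filter (fun p => 2 ≤ p.1 ∧ 2 ≤ p.2),
        ∑ s ∈ Finset.range p.1,
          ((p.1 : ℤ) + s * (p.2 + 1)).negOnePow •
            insertOp (m p.1) ((p.2 : ℤ) - 2) (m p.2) s g a

end HomotopyAlg

/-! An `A(∞)` structure on `U` is the same as a square-zero odd coderivation of the tensor coalgebra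
on the suspension of `U`, so it can be transported along any coalgebra automorphism. After the sign
change of suspension, `(d, μ)` becomes the bar differential `D` with components `d` and `m`, and the
homotopy becomes an even binary map `η`. Let `F` be the coalgebra automorphism with components
`letter + η`. Then `F D F⁻¹` again squares to zero; its unary component is `d`, and its binary
component is `m` corrected by the boundary of `η`, which is `ν` after desuspension.

Everything is done with components, that is, with functions on words. The inverse `G = F⁻¹` has
components `g = treeSum η`, determined recursively by `g = letter - η (g ⊗ g)`. The components of `D
G` are `β = d g + m (g ⊗ g)` (`transferAux`), and those of `F D G` are `b = β + η (β ⊗ g) + η (gε ⊗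
β)` (`transfer`). Writing `coder ε b φ` for `φ` composed with the coderivation of `b`, the argument
has three steps: `coder b g = β`, which says `G (F D G) = D G` (`coder_transfer_treeSum`); `coder b
β = 0`, which comes from `D² = 0` (`coder_transfer_transferAux`); and hence `coder b b = 0`
(`coder_transfer_transfer`). All three rest on the coderivation rule `conv_coder`.

Finally `isAInfinity_of_bar` removes the suspension: the `n`-ary operation is `b` evaluated after
applying `ε ^ r` to each letter followed by `r` others, and the sign comparison is made modulo 2. -/

namespace HomotopyAlg

/-! ### Sums over deconcatenations of a word. -/

section SplitSum

variable {α β M N : Type*} [AddCommGroup M] [AddCommGroup N]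

/-- The sum of `F y z` over all ways to write the word `w` as a concatenation `y ++ z`. -/
def splitSum (F : List α → List α → M) (w : List α) : M :=
  ∑ i ∈ Finset.range (w.length + 1), F (w.take i) (w.drop i)

theorem splitSum_nil (F : List α → List α → M) : splitSum F [] = F [] [] := by
  simp [splitSum]

theorem splitSum_cons (F : List α → List α → M) (a : α) (w : List α) :
    splitSum F (a :: w) = F [] (a :: w) + splitSum (fun y z => F (a :: y) z) w := by
  simp only [splitSum, List.length_cons]
  rw [Finset.sum_range_succ']
  simp [add_comm]

theorem splitSum_congr {F G : List α → List α → M} {w : List α}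
    (h : ∀ y z, y ++ z = w → F y z = G y z) : splitSum F w = splitSum G w :=
  Finset.sum_congr rfl fun i _ => h _ _ (List.take_append_drop i w)

theorem splitSum_add (F G : List α → List α → M) (w : List α) :
    splitSum (fun y z => F y z + G y z) w = splitSum F w + splitSum G w :=
  Finset.sum_add_distrib

theorem splitSum_sub (F G : List α → List α → M) (w : List α) :
    splitSum (fun y z => F y z - G y z) w = splitSum F w - splitSum G w :=
  Finset.sum_sub_distrib _ _

theorem splitSum_zero (w : List α) : splitSum (fun _ _ => (0 : M)) w = 0 :=
  Finset.sum_const_zero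

theorem map_splitSum (f : M →+ N) (F : List α → List α → M) (w : List α) :
    f (splitSum F w) = splitSum (fun y z => f (F y z)) w :=
  map_sum f _ _

theorem splitSum_comm (F : List α → List α → List α → List α → M) (v w : List α) :
    splitSum (fun a b => splitSum (fun y z => F a b y z) w) v =
      splitSum (fun y z => splitSum (fun a b => F a b y z) v) w :=
  Finset.sum_comm

theorem splitSum_map (f : β → α) (F : List α → List α → M) (w : List β) :
    splitSum F (w.map f) = splitSum (fun y z => F (y.map f) (z.map f)) w := by
  simp [splitSum, List.map_take, List.map_drop]

/-- Coassociativity of deconcatenation: both sides run over all cuts of `w` into three pieces. -/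
theorem splitSum_assoc (F : List α → List α → List α → M) (w : List α) :
    splitSum (fun u z => splitSum (fun x y => F x y z) u) w =
      splitSum (fun x v => splitSum (fun y z => F x y z) v) w := by
  induction w generalizing F with
  | nil => simp [splitSum_nil]
  | cons a w ih =>
    simp only [splitSum_cons, splitSum_nil, splitSum_add]
    rw [ih fun x y z => F (a :: x) y z, add_assoc]

/-- A cut falls either before or after the marked letter `a`. This is what makes products behave
well under inserting a letter. -/
theorem splitSum_append_cons (F : List α → List α → M) (x z : List α) (a : α) :
    splitSum F (x ++ a :: z) =
      splitSum (fun x₁ x₂ => F x₁ (x₂ ++ a :: z)) x +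
        splitSum (fun z₁ z₂ => F (x ++ a :: z₁) z₂) z := by
  induction x generalizing F with
  | nil => simp [splitSum_nil, splitSum_cons]
  | cons c x ih => simp [splitSum_cons, ih, add_assoc]

theorem splitSum_eq_left {F : List α → List α → M} (h : ∀ a y z, F (a :: y) z = 0) (w : List α) :
    splitSum F w = F [] w := by
  cases w with
  | nil => simp [splitSum_nil]
  | cons a w => simp [splitSum_cons, h, splitSum_zero]

theorem splitSum_eq_right {F : List α → List α → M} (h : ∀ a y z, F y (a :: z) = 0)
    (w : List α) : splitSum F w = F w [] := by
  induction w generalizing F with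
  | nil => simp [splitSum_nil]
  | cons a w ih => simp [splitSum_cons, h, ih fun b y z => h b (a :: y) z]

end SplitSum

/-! ### Convolution, coderivations and the transferred bar differential. -/

section Words

variable {k : Type*} [Field k] {U : Type*} [AddCommGroup U] [Module k U]

/-- The convolution product of two functions on words, along a bilinear map `f`. -/
def conv (f : U →ₗ[k] U →ₗ[k] U) (φ ψ : List U → U) (w : List U) : U :=
  splitSum (fun y z => f (φ y) (ψ z)) w

/-- The composition of a function `φ` on words with the coderivation whose components are `b`,
with signs given by the grading involution `ε`. -/
def coder (ε : U →ₗ[k] U) (b φ : List U → U) (w : List U) : U :=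
  splitSum (fun x v => splitSum (fun y z => φ (x.map ε ++ b y :: z)) v) w

/-- The projection of words onto words of length one. -/
def letter : List U → U
  | [a] => a
  | _ => 0

theorem coder_sub (ε : U →ₗ[k] U) (b φ ψ : List U → U) (w : List U) :
    coder ε b (fun w => φ w - ψ w) w = coder ε b φ w - coder ε b ψ w := by
  simp only [coder, splitSum_sub]

theorem coder_add (ε : U →ₗ[k] U) (b φ ψ : List U → U) (w : List U) :
    coder ε b (fun w => φ w + ψ w) w = coder ε b φ w + coder ε b ψ w := by
  simp only [coder, splitSum_add]

theorem coder_comp (ε : U →ₗ[k] U) (b φ : List U → U) (f : U →ₗ[k] U) (w : List U) :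
    coder ε b (fun w => f (φ w)) w = f (coder ε b φ w) := by
  have h := fun F (w : List U) => map_splitSum f.toAddMonoidHom F w
  simp only [LinearMap.toAddMonoidHom_coe] at h
  simp only [coder, h]

/-- A coderivation is recovered from its projection to words of length one: only the term with empty
outer pieces has length one. -/
theorem coder_letter (ε : U →ₗ[k] U) (b : List U → U) (w : List U) :
    coder ε b letter w = b w := by
  unfold coder
  rw [splitSum_eq_left, splitSum_eq_right]
  · simp [letter]
  · intro a y z; simp [letter]
  · intro a x v
    have : ∀ y z, letter ((a :: x).map ε ++ b y :: z) = 0 := by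
      intro y z
      cases x <;> simp [letter]
    simp only [this, splitSum_zero]

/-- The coderivation rule. The inserted letter `b y` lies in the left or the right factor; in the
second case the odd `b` has passed the whole left factor, which therefore carries `ε`. -/
theorem conv_coder (ε : U →ₗ[k] U) (b : List U → U) (f : U →ₗ[k] U →ₗ[k] U) (φ ψ : List U → U)
    (w : List U) :
    coder ε b (conv f φ ψ) w =
      conv f (coder ε b φ) ψ w + conv f (fun w => φ (w.map ε)) (coder ε b ψ) w := by
  have hr : ∀ (a : U) (F : List U → List U → U) (w : List U),
      f a (splitSum F w) = splitSum (fun y z => f a (F y z)) w :=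
    fun a F w => map_splitSum (f a).toAddMonoidHom F w
  have hl : ∀ (a : U) (F : List U → List U → U) (w : List U),
      f (splitSum F w) a = splitSum (fun y z => f (F y z) a) w :=
    fun a F w => map_splitSum (f.flip a).toAddMonoidHom F w
  simp only [conv, coder, splitSum_append_cons, splitSum_add, splitSum_map, hr, hl]
  rw [add_comm]
  congr 1
  · rw [splitSum_assoc fun x v z₂ => splitSum (fun y z₁ => f (φ (x.map ε ++ b y :: z₁)) (ψ z₂)) v]
    refine splitSum_congr fun x v _ => ?_
    rw [splitSum_assoc fun y z₁ z₂ => f (φ (x.map ε ++ b y :: z₁)) (ψ z₂)]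
  · rw [← splitSum_assoc fun x₁ x₂ v =>
      splitSum (fun y z => f (φ (x₁.map ε)) (ψ (x₂.map ε ++ b y :: z))) v]
    refine splitSum_congr fun x v _ => ?_
    rw [splitSum_comm]

/-- An odd coderivation anticommutes with the grading involution of the tensor coalgebra. -/
theorem coder_map {ε : U →ₗ[k] U} {b φ : List U → U}
    (hb : ∀ w, ε (b w) = -b (w.map ε))
    (hφ : ∀ x a z, φ (x ++ (-a) :: z) = -φ (x ++ a :: z)) (w : List U) :
    coder ε b (fun w => φ (w.map ε)) w = -coder ε b φ (w.map ε) := by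
  have h := fun F (w : List U) => map_splitSum (-AddMonoidHom.id U) F w
  simp only [AddMonoidHom.neg_apply, AddMonoidHom.id_apply] at h
  simp only [coder, splitSum_map, h]
  simp [hb, hφ]

/-- The function `φ` on words is linear in each letter. -/
structure IsMultilin (k : Type*) [Field k] {U : Type*} [AddCommGroup U] [Module k U]
    (φ : List U → U) : Prop where
  add : ∀ x a b z, φ (x ++ (a + b) :: z) = φ (x ++ a :: z) + φ (x ++ b :: z)
  smul : ∀ x (c : k) a z, φ (x ++ (c • a) :: z) = c • φ (x ++ a :: z)

theorem IsMultilin.zero {φ : List U → U} (h : IsMultilin k φ) (x z : List U) :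
    φ (x ++ 0 :: z) = 0 := by
  simpa using h.smul x 0 0 z

theorem IsMultilin.neg {φ : List U → U} (h : IsMultilin k φ) (x : List U) (a : U) (z : List U) :
    φ (x ++ (-a) :: z) = -φ (x ++ a :: z) := by
  simpa using h.smul x (-1) a z

theorem isMultilin_zero : IsMultilin k fun _ : List U => (0 : U) := by
  constructor <;> simp

theorem isMultilin_letter : IsMultilin k (letter : List U → U) := by
  constructor
  · rintro (_ | ⟨c, _ | ⟨c', x⟩⟩) a b (_ | ⟨e, z⟩) <;> simp [letter]
  · rintro (_ | ⟨c, _ | ⟨c', x⟩⟩) r a (_ | ⟨e, z⟩) <;> simp [letter]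

theorem IsMultilin.add_fun {φ ψ : List U → U} (hφ : IsMultilin k φ) (hψ : IsMultilin k ψ) :
    IsMultilin k fun w => φ w + ψ w :=
  ⟨fun x a b z => by rw [hφ.add, hψ.add]; abel, fun x c a z => by rw [hφ.smul, hψ.smul, smul_add]⟩

theorem IsMultilin.comp {φ : List U → U} (hφ : IsMultilin k φ) (f : U →ₗ[k] U) :
    IsMultilin k fun w => f (φ w) :=
  ⟨fun x a b z => by rw [hφ.add, map_add], fun x c a z => by rw [hφ.smul, map_smul]⟩

theorem IsMultilin.sub_fun {φ ψ : List U → U} (hφ : IsMultilin k φ) (hψ : IsMultilin k ψ) :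
    IsMultilin k fun w => φ w - ψ w := by
  simpa [sub_eq_add_neg] using hφ.add_fun (hψ.comp (-LinearMap.id))

theorem IsMultilin.map {φ : List U → U} (hφ : IsMultilin k φ) (f : U →ₗ[k] U) :
    IsMultilin k fun w => φ (w.map f) :=
  ⟨fun x a b z => by simp [hφ.add], fun x c a z => by simp [hφ.smul]⟩

theorem IsMultilin.conv {φ ψ : List U → U} (hφ : IsMultilin k φ) (hψ : IsMultilin k ψ)
    (f : U →ₗ[k] U →ₗ[k] U) : IsMultilin k (conv f φ ψ) := by
  constructor
  · intro x a b z
    simp only [HomotopyAlg.conv, splitSum_append_cons, hφ.add, hψ.add, map_add,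
      LinearMap.add_apply, splitSum_add]
    abel
  · intro x c a z
    simp only [HomotopyAlg.conv, splitSum_append_cons, hφ.smul, hψ.smul, map_smul,
      LinearMap.smul_apply, smul_add]
    simp only [splitSum, Finset.smul_sum]

/-- A differential graded associative structure `(d, m)` and a homotopy `η`, in the sign
conventions of the suspension of `U`, whose grading involution is `ε`. -/
structure BarData (ε d : U →ₗ[k] U) (m η : U →ₗ[k] U →ₗ[k] U) : Prop where
  odd_d : ∀ a, ε (d a) = -d (ε a)
  odd_m : ∀ a b, ε (m a b) = -m (ε a) (ε b)
  even_η : ∀ a b, ε (η a b) = η (ε a) (ε b)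
  square : ∀ a, d (d a) = 0
  leibniz : ∀ a b, d (m a b) + m (d a) b + m (ε a) (d b) = 0
  assoc : ∀ a b c, m (m a b) c + m (ε a) (m b c) = 0

/-- Approximations to the solution `g` of `g = letter - η (g ⊗ g)`. -/
def treeApprox (η : U →ₗ[k] U →ₗ[k] U) : ℕ → List U → U
  | 0 => fun _ => 0
  | n + 1 => fun w => letter w - conv η (treeApprox η n) (treeApprox η n) w

/-- The signed sum over all planar binary trees of the iterates of `η`. -/
def treeSum (η : U →ₗ[k] U →ₗ[k] U) (w : List U) : U := treeApprox η w.length w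

theorem treeApprox_nil (η : U →ₗ[k] U →ₗ[k] U) (n : ℕ) : treeApprox η n [] = 0 := by
  induction n with
  | zero => rfl
  | succ n ih => simp [treeApprox, conv, splitSum_nil, ih, letter]

/-- The approximations vanish on the empty word, so only cuts into two strictly shorter words
contribute, and the recursion is stable once its depth reaches the length. -/
theorem treeApprox_succ (η : U →ₗ[k] U →ₗ[k] U) (n : ℕ) (w : List U) (h : w.length ≤ n) :
    treeApprox η (n + 1) w = treeApprox η n w := by
  induction n generalizing w with
  | zero =>
    obtain rfl : w = [] := by simpa using h
    simp [treeApprox_nil]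
  | succ n ih =>
    refine congrArg (letter w - ·) (splitSum_congr fun y z hw => ?_)
    subst hw
    rcases y with _ | ⟨a, y⟩
    · simp [treeApprox_nil]
    rcases z with _ | ⟨c, z⟩
    · simp [treeApprox_nil]
    simp only [List.length_append, List.length_cons] at h
    rw [ih, ih] <;> simp only [List.length_cons] <;> omega

theorem treeApprox_eq (η : U →ₗ[k] U →ₗ[k] U) (n : ℕ) (w : List U) (h : w.length ≤ n) :
    treeApprox η n w = treeSum η w := by
  induction n, h using Nat.le_induction with
  | base => rfl
  | succ n hn ih => rw [treeApprox_succ η n w hn, ih]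

theorem treeSum_nil (η : U →ₗ[k] U →ₗ[k] U) : treeSum η [] = 0 := rfl

theorem treeSum_eq (η : U →ₗ[k] U →ₗ[k] U) (w : List U) :
    treeSum η w = letter w - conv η (treeSum η) (treeSum η) w := by
  rw [← treeApprox_eq η (w.length + 1) w (by omega), treeApprox]
  refine congrArg (letter w - ·) (splitSum_congr fun y z hw => ?_)
  subst hw
  rw [treeApprox_eq, treeApprox_eq] <;> simp

theorem isMultilin_treeApprox (η : U →ₗ[k] U →ₗ[k] U) (n : ℕ) :
    IsMultilin k (treeApprox η n) := by
  induction n with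
  | zero => exact isMultilin_zero
  | succ n ih => exact isMultilin_letter.sub_fun (ih.conv ih η)

theorem isMultilin_treeSum (η : U →ₗ[k] U →ₗ[k] U) : IsMultilin k (treeSum η) := by
  constructor
  · intro x a b z
    simpa [treeSum] using (isMultilin_treeApprox η _).add x a b z
  · intro x c a z
    simpa [treeSum] using (isMultilin_treeApprox η _).smul x c a z

/-- The composition of the differential graded structure `(d, m)` with the coalgebra map whose
components are `treeSum η`. -/
def transferAux (d : U →ₗ[k] U) (m η : U →ₗ[k] U →ₗ[k] U) (w : List U) : U :=
  d (treeSum η w) + conv m (treeSum η) (treeSum η) w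

/-- The components of the conjugate of the bar differential of `(d, m)` by the coalgebra
automorphism whose inverse has components `treeSum η`. -/
def transfer (ε d : U →ₗ[k] U) (m η : U →ₗ[k] U →ₗ[k] U) (w : List U) : U :=
  transferAux d m η w + conv η (transferAux d m η) (treeSum η) w +
    conv η (fun w => treeSum η (w.map ε)) (transferAux d m η) w

theorem isMultilin_transferAux (d : U →ₗ[k] U) (m η : U →ₗ[k] U →ₗ[k] U) :
    IsMultilin k (transferAux d m η) :=
  have hg := isMultilin_treeSum η
  (hg.comp d).add_fun (hg.conv hg m)

theorem isMultilin_transfer (ε d : U →ₗ[k] U) (m η : U →ₗ[k] U →ₗ[k] U) :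
    IsMultilin k (transfer ε d m η) :=
  have hg := isMultilin_treeSum η
  have hβ := isMultilin_transferAux d m η
  (hβ.add_fun (hβ.conv hg η)).add_fun ((hg.map ε).conv hβ η)

theorem transferAux_nil (d : U →ₗ[k] U) (m η : U →ₗ[k] U →ₗ[k] U) :
    transferAux d m η [] = 0 := by
  simp [transferAux, conv, splitSum_nil, treeSum_nil]

theorem transfer_nil (ε d : U →ₗ[k] U) (m η : U →ₗ[k] U →ₗ[k] U) :
    transfer ε d m η [] = 0 := by
  simp [transfer, conv, splitSum_nil, treeSum_nil, transferAux_nil]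

theorem map_conv (f : U →ₗ[k] U) (η : U →ₗ[k] U →ₗ[k] U) (φ ψ : List U → U) (w : List U) :
    f (conv η φ ψ w) = splitSum (fun y z => f (η (φ y) (ψ z))) w :=
  map_splitSum f.toAddMonoidHom _ w

theorem splitSum_neg {α M : Type*} [AddCommGroup M] (F : List α → List α → M) (w : List α) :
    splitSum (fun y z => -F y z) w = -splitSum F w :=
  Finset.sum_neg_distrib _

theorem map_conv_even {f : U →ₗ[k] U} {η : U →ₗ[k] U →ₗ[k] U} {φ ψ φ' ψ' : List U → U}
    (w : List U) (h : ∀ y z, f (η (φ y) (ψ z)) = η (φ' (y.map f)) (ψ' (z.map f))) :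
    f (conv η φ ψ w) = conv η φ' ψ' (w.map f) := by
  rw [map_conv, conv, splitSum_map]
  simp only [h]

theorem map_conv_odd {f : U →ₗ[k] U} {η : U →ₗ[k] U →ₗ[k] U} {φ ψ φ' ψ' : List U → U}
    (w : List U) (h : ∀ y z, f (η (φ y) (ψ z)) = -η (φ' (y.map f)) (ψ' (z.map f))) :
    f (conv η φ ψ w) = -conv η φ' ψ' (w.map f) := by
  rw [map_conv, conv, splitSum_map, ← splitSum_neg]
  simp only [h]

theorem map_letter (f : U →ₗ[k] U) (w : List U) : f (letter w) = letter (w.map f) := by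
  rcases w with _ | ⟨c, _ | ⟨c', w⟩⟩ <;> simp [letter]

/-- The intertwining relation `G (F D G) = D G` in components. Expanding `g = letter - η (g ⊗ g)`
and using the coderivation rule, the `η` terms are by induction on the length exactly the correction
terms in `transfer`, so they cancel. -/
theorem coder_transfer_treeSum (ε d : U →ₗ[k] U) (m η : U →ₗ[k] U →ₗ[k] U) (w : List U) :
    coder ε (transfer ε d m η) (treeSum η) w = transferAux d m η w := by
  induction hn : w.length using Nat.strong_induction_on generalizing w with
  | _ n ih =>
    subst hn
    have e : treeSum η = fun w => letter w - conv η (treeSum η) (treeSum η) w :=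
      funext (treeSum_eq η)
    conv_lhs => rw [e]
    rw [coder_sub, coder_letter, conv_coder]
    have h₁ : conv η (coder ε (transfer ε d m η) (treeSum η)) (treeSum η) w =
        conv η (transferAux d m η) (treeSum η) w := by
      refine splitSum_congr fun y z hw => ?_
      -- For `z` empty the left factor is all of `w`, out of reach of the induction, but `treeSum η
      -- [] = 0` kills the term.
      rcases z with _ | ⟨c, z⟩
      · simp [treeSum_nil]
      · rw [ih y.length (by simp [← hw]) y rfl]
    have h₂ : conv η (fun w => treeSum η (w.map ε)) (coder ε (transfer ε d m η) (treeSum η)) w =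
        conv η (fun w => treeSum η (w.map ε)) (transferAux d m η) w := by
      refine splitSum_congr fun y z hw => ?_
      rcases y with _ | ⟨c, y⟩
      · simp [treeSum_nil]
      · rw [ih z.length (by simp [← hw]) z rfl]
    rw [h₁, h₂, transfer]
    abel

namespace BarData

variable {ε d : U →ₗ[k] U} {m η : U →ₗ[k] U →ₗ[k] U}

theorem map_treeSum (H : BarData ε d m η) (w : List U) :
    ε (treeSum η w) = treeSum η (w.map ε) := by
  have key : ∀ n w, ε (treeApprox η n w) = treeApprox η n (w.map ε) := by
    intro n
    induction n with
    | zero => simp [treeApprox]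
    | succ n ih =>
      intro w
      rw [treeApprox, map_sub, map_letter,
        map_conv_even (φ' := treeApprox η n) (ψ' := treeApprox η n) w fun y z => by
          rw [H.even_η, ih, ih]]
  simpa [treeSum] using key w.length w

theorem map_transferAux (H : BarData ε d m η) (w : List U) :
    ε (transferAux d m η w) = -transferAux d m η (w.map ε) := by
  rw [transferAux, map_add, H.odd_d, H.map_treeSum,
    map_conv_odd (φ' := treeSum η) (ψ' := treeSum η) w fun y z => by
      rw [H.odd_m, H.map_treeSum, H.map_treeSum], transferAux, neg_add]

theorem map_transfer (H : BarData ε d m η) (w : List U) :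
    ε (transfer ε d m η w) = -transfer ε d m η (w.map ε) := by
  rw [transfer, map_add, map_add, H.map_transferAux,
    map_conv_odd (φ' := transferAux d m η) (ψ' := treeSum η) w fun y z => by
      rw [H.even_η, H.map_transferAux, H.map_treeSum, map_neg, LinearMap.neg_apply],
    map_conv_odd (φ' := fun w => treeSum η (w.map ε)) (ψ' := transferAux d m η) w fun y z => by
      rw [H.even_η, H.map_transferAux, H.map_treeSum, map_neg],
    transfer, neg_add, neg_add]

/-- This is `D² = 0` applied after `G`: replacing `coder b g` by `β` leaves `d β + m (β ⊗ g) + m (gε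
⊗ β)`. With `β` expanded, the `d d` term vanishes, the terms with one `d` cancel by Leibniz (`h₁`),
and those with none by associativity (`h₂`). -/
theorem coder_transfer_transferAux (H : BarData ε d m η) (w : List U) :
    coder ε (transfer ε d m η) (transferAux d m η) w = 0 := by
  have e : coder ε (transfer ε d m η) (treeSum η) = transferAux d m η :=
    funext (coder_transfer_treeSum ε d m η)
  set b := transfer ε d m η with hb
  set g := treeSum η with hg
  have h₀ : transferAux d m η = fun w => d (g w) + conv m g g w := rfl
  conv_lhs => rw [h₀]
  rw [coder_add, coder_comp, conv_coder, e, h₀]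
  dsimp only
  rw [map_add, H.square, zero_add]
  have hl : ∀ (F : List U → List U → U) (a : U) (w : List U),
      m (splitSum F w) a = splitSum (fun y z => m (F y z) a) w :=
    fun F a w => map_splitSum (m.flip a).toAddMonoidHom F w
  have hr : ∀ (F : List U → List U → U) (a : U) (w : List U),
      m a (splitSum F w) = splitSum (fun y z => m a (F y z)) w :=
    fun F a w => map_splitSum (m a).toAddMonoidHom F w
  have h₁ : d (conv m g g w) + splitSum (fun y z => m (d (g y)) (g z)) w
      + splitSum (fun y z => m (g (y.map ε)) (d (g z))) w = 0 := by
    rw [map_conv, ← splitSum_add, ← splitSum_add]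
    simp only [hg, ← H.map_treeSum, H.leibniz, splitSum_zero]
  have h₂ : splitSum (fun y z => m (conv m g g y) (g z)) w
      + splitSum (fun y z => m (g (y.map ε)) (conv m g g z)) w = 0 := by
    simp only [HomotopyAlg.conv, hl, hr]
    rw [splitSum_assoc fun x y z => m (m (g x) (g y)) (g z), ← splitSum_add]
    simp only [← splitSum_add, hg, ← H.map_treeSum, H.assoc, splitSum_zero]
  simp only [HomotopyAlg.conv, map_add, LinearMap.add_apply, splitSum_add] at h₁ h₂ ⊢
  have h := congrArg₂ (· + ·) h₁ h₂
  rw [add_zero] at h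
  rw [← h]
  abel

/-- Since `coder b β = 0`, only two terms survive, `η (βε ⊗ β)` from `η (β ⊗ g)` and its negative
from `η (gε ⊗ β)`. -/
theorem coder_transfer_transfer (H : BarData ε d m η) (w : List U) :
    coder ε (transfer ε d m η) (transfer ε d m η) w = 0 := by
  have e : coder ε (transfer ε d m η) (treeSum η) = transferAux d m η :=
    funext (coder_transfer_treeSum ε d m η)
  have e₀ : coder ε (transfer ε d m η) (transferAux d m η) = fun _ => 0 :=
    funext H.coder_transfer_transferAux
  have e₁ : coder ε (transfer ε d m η) (fun w => treeSum η (w.map ε)) =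
      fun w => -transferAux d m η (w.map ε) := by
    funext w
    rw [coder_map H.map_transfer (isMultilin_treeSum η).neg, e]
  rw [show coder ε (transfer ε d m η) (transfer ε d m η) w = coder ε (transfer ε d m η) (fun w =>
    (transferAux d m η w + conv η (transferAux d m η) (treeSum η) w) +
      conv η (fun w => treeSum η (w.map ε)) (transferAux d m η) w) w from rfl,
    coder_add, coder_add, conv_coder, conv_coder, e₀, e₁, e]
  simp [HomotopyAlg.conv, splitSum_zero, splitSum_neg]

end BarData

end Words

variable {k : Type*} [Field k] {U : Type*} [AddCommGroup U] [Module k U]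

/-! ### Degrees and Koszul signs on homogeneous words. -/

section Degrees

/-- The word `w` consists of homogeneous letters, whose degrees are listed by `I`. -/
abbrev IsHomogWord (𝒰 : ℤ → Submodule k U) (I : List ℤ) (w : List U) : Prop :=
  List.Forall₂ (fun i a => a ∈ 𝒰 i) I w

/-- The function `φ` on words has degree `n + e` on words of length `n`. -/
def HasWordDegree (𝒰 : ℤ → Submodule k U) (e : ℤ) (φ : List U → U) : Prop :=
  ∀ I w, IsHomogWord 𝒰 I w → φ w ∈ 𝒰 (I.sum + I.length + e)

variable {𝒰 : ℤ → Submodule k U} {e e₁ e₂ : ℤ} {φ ψ : List U → U}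

/-- Word degree `e` is degree `e + 1` on the suspension: `-1` is the degree of components of
coalgebra maps, `-2` that of a differential. -/
theorem hasWordDegree_letter : HasWordDegree 𝒰 (-1) (letter : List U → U) := by
  rintro I w (_ | ⟨h, _ | _⟩)
  · exact zero_mem _
  · simpa [letter] using h
  · exact zero_mem _

theorem HasWordDegree.add (hφ : HasWordDegree 𝒰 e φ) (hψ : HasWordDegree 𝒰 e ψ) :
    HasWordDegree 𝒰 e fun w => φ w + ψ w :=
  fun I w h => add_mem (hφ I w h) (hψ I w h)

theorem HasWordDegree.sub (hφ : HasWordDegree 𝒰 e φ) (hψ : HasWordDegree 𝒰 e ψ) :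
    HasWordDegree 𝒰 e fun w => φ w - ψ w :=
  fun I w h => sub_mem (hφ I w h) (hψ I w h)

theorem HasWordDegree.conv {f : U →ₗ[k] U →ₗ[k] U} (hφ : HasWordDegree 𝒰 e₁ φ)
    (hψ : HasWordDegree 𝒰 e₂ ψ) (hf : IsBilinOfDegree 𝒰 e f) :
    HasWordDegree 𝒰 (e₁ + e₂ + e) (conv f φ ψ) := by
  intro I w h
  rw [HomotopyAlg.conv, splitSum]
  refine Submodule.sum_mem _ fun i _ => ?_
  have := hf _ _ _ _ (hφ _ _ (List.forall₂_take i h)) (hψ _ _ (List.forall₂_drop i h))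
  have hs := List.sum_take_add_sum_drop I i
  have hl : ((I.take i).length : ℤ) + (I.drop i).length = I.length := by
    rw [← Nat.cast_add, ← List.length_append, List.take_append_drop]
  convert this using 2
  linarith

theorem IsHomogWord.map {I : List ℤ} {w : List U} (h : IsHomogWord 𝒰 I w) {f : U →ₗ[k] U}
    (hf : ∀ i, ∀ a ∈ 𝒰 i, f a ∈ 𝒰 i) : IsHomogWord 𝒰 I (w.map f) :=
  List.forall₂_map_right_iff.2 (h.imp fun i a => hf i a)

theorem HasWordDegree.map (hφ : HasWordDegree 𝒰 e φ) {f : U →ₗ[k] U}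
    (hf : ∀ i, ∀ a ∈ 𝒰 i, f a ∈ 𝒰 i) : HasWordDegree 𝒰 e fun w => φ (w.map f) :=
  fun I _ h => hφ I _ (h.map hf)

theorem HasWordDegree.comp (hφ : HasWordDegree 𝒰 e φ) {d : U →ₗ[k] U}
    (hd : ∀ i, ∀ a ∈ 𝒰 i, d a ∈ 𝒰 (i - 1)) : HasWordDegree 𝒰 (e - 1) fun w => d (φ w) := by
  intro I w h
  rw [← add_sub_assoc]
  exact hd _ _ (hφ I w h)

theorem hasWordDegree_treeSum {η : U →ₗ[k] U →ₗ[k] U} (hη : IsBilinOfDegree 𝒰 1 η) :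
    HasWordDegree 𝒰 (-1) (treeSum η) := by
  have key : ∀ n, HasWordDegree 𝒰 (-1) (treeApprox η n) := by
    intro n
    induction n with
    | zero => exact fun I w _ => zero_mem _
    | succ n ih => exact hasWordDegree_letter.sub (ih.conv ih hη)
  exact fun I w h => key w.length I w h

theorem hasWordDegree_transfer {ε d : U →ₗ[k] U} {m η : U →ₗ[k] U →ₗ[k] U}
    (hε : ∀ i, ∀ a ∈ 𝒰 i, ε a ∈ 𝒰 i) (hd : ∀ i, ∀ a ∈ 𝒰 i, d a ∈ 𝒰 (i - 1))
    (hm : IsBilinOfDegree 𝒰 0 m) (hη : IsBilinOfDegree 𝒰 1 η) :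
    HasWordDegree 𝒰 (-2) (transfer ε d m η) := by
  have hg := hasWordDegree_treeSum hη
  have hβ : HasWordDegree 𝒰 (-2) (transferAux d m η) := (hg.comp hd).add (hg.conv hg hm)
  exact (hβ.add (hβ.conv hg hη)).add ((hg.map hε).conv hβ hη)

theorem IsMultilin.units_smul (hφ : IsMultilin k φ) (x : List U) (u : ℤˣ) (a : U) (z : List U) :
    φ (x ++ (u • a) :: z) = u • φ (x ++ a :: z) := by
  rcases Int.units_eq_one_or u with rfl | rfl <;> simp [Units.smul_def, hφ.neg]

theorem IsMultilin.map_sign (hφ : IsMultilin k φ) {ε : U →ₗ[k] U}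
    (hε : ∀ i, ∀ a ∈ 𝒰 i, ε a = (i + 1).negOnePow • a) {I : List ℤ} {x : List U}
    (h : IsHomogWord 𝒰 I x) (p t : List U) :
    φ (p ++ (x.map ε ++ t)) = (I.sum + I.length).negOnePow • φ (p ++ (x ++ t)) := by
  induction h generalizing p with
  | nil => simp
  | @cons i a I x ha _ ih =>
    have := ih (p ++ [ε a])
    simp only [List.append_assoc, List.cons_append, List.nil_append] at this
    simp only [List.map_cons, List.cons_append, this, List.sum_cons, List.length_cons]
    rw [hε i a ha, hφ.units_smul, smul_smul, ← Int.negOnePow_add]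
    congr 2
    push_cast
    ring

theorem IsMultilin.map_sign_pow (hφ : IsMultilin k φ) {ε : U →ₗ[k] U}
    (hε : ∀ i, ∀ a ∈ 𝒰 i, ε a = (i + 1).negOnePow • a) {I : List ℤ} {x : List U}
    (h : IsHomogWord 𝒰 I x) (t : List U) (j : ℕ) :
    φ (x.map (ε ^ j : U →ₗ[k] U) ++ t) = (j * (I.sum + I.length)).negOnePow • φ (x ++ t) := by
  have hmem : ∀ i, ∀ a ∈ 𝒰 i, ε a ∈ 𝒰 i := by
    intro i a ha
    rw [hε i a ha, Units.smul_def]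
    exact zsmul_mem ha _
  induction j generalizing x with
  | zero => simp [Module.End.one_eq_id]
  | succ j ih =>
    have : x.map (ε ^ (j + 1) : U →ₗ[k] U) = (x.map ε).map (ε ^ j : U →ₗ[k] U) := by
      simp [pow_succ]
    have h' := hφ.map_sign hε h [] t
    simp only [List.nil_append] at h'
    rw [this, ih (h.map hmem), h', smul_smul, ← Int.negOnePow_add]
    congr 2
    push_cast
    ring

end Degrees

/-! ### The sign twist between bar components and `A(∞)` operations. -/

section Twist

/-- The sign by which the components of a bar differential differ from the operations of an
`A(∞)`-algebra, as an operation on words: a letter followed by `n` letters is acted on by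
`ε ^ n`. -/
def twist (ε : U →ₗ[k] U) : List U → List U
  | [] => []
  | a :: w => (ε ^ w.length) a :: twist ε w

theorem length_twist (ε : U →ₗ[k] U) (w : List U) : (twist ε w).length = w.length := by
  induction w with
  | nil => rfl
  | cons a w ih => simp [twist, ih]

theorem twist_append (ε : U →ₗ[k] U) (x y : List U) :
    twist ε (x ++ y) = (twist ε x).map (ε ^ y.length : U →ₗ[k] U) ++ twist ε y := by
  induction x with
  | nil => simp [twist]
  | cons a x ih => simp [twist, ih, add_comm x.length, pow_add]

theorem IsHomogWord.twist {𝒰 : ℤ → Submodule k U} {ε : U →ₗ[k] U}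
    (hε : ∀ i, ∀ a ∈ 𝒰 i, ε a ∈ 𝒰 i) {I : List ℤ} {w : List U} (h : IsHomogWord 𝒰 I w) :
    IsHomogWord 𝒰 I (twist ε w) := by
  have hpow : ∀ n i, ∀ a ∈ 𝒰 i, (ε ^ n) a ∈ 𝒰 i := by
    intro n i a ha
    induction n with
    | zero => simpa
    | succ n ih =>
      rw [pow_succ']
      exact hε _ _ ih
  induction h with
  | nil => exact .nil
  | cons ha _ ih => exact .cons (hpow _ _ _ ha) ih

theorem IsMultilin.twist {φ : List U → U} (hφ : IsMultilin k φ) (ε : U →ₗ[k] U) :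
    IsMultilin k fun w => φ (twist ε w) := by
  constructor <;> intros <;> simp [twist_append, HomotopyAlg.twist, hφ.add, hφ.smul]

/-- The twist counts the letters that follow, so the left piece of a cut carries an additional `ε`
for each letter of the right piece. -/
theorem splitSum_twist {M : Type*} [AddCommGroup M] (ε : U →ₗ[k] U) (F : List U → List U → M)
    (w : List U) :
    splitSum F (twist ε w) =
      splitSum (fun x v => F ((twist ε x).map (ε ^ v.length : U →ₗ[k] U)) (twist ε v)) w := by
  rw [splitSum, splitSum, length_twist]
  refine Finset.sum_congr rfl fun i hi => ?_
  have hw : twist ε w = (twist ε (w.take i)).map (ε ^ (w.drop i).length : U →ₗ[k] U) ++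
      twist ε (w.drop i) := by
    rw [← twist_append, List.take_append_drop]
  have hl : ((twist ε (w.take i)).map (ε ^ (w.drop i).length : U →ₗ[k] U)).length = i := by
    simp only [List.length_map, length_twist, List.length_take, Finset.mem_range] at hi ⊢
    omega
  rw [hw, List.take_left' hl, List.drop_left' hl]

theorem map_pow_odd {ε : U →ₗ[k] U} {b : List U → U}
    (hb : ∀ w, ε (b w) = -b (w.map ε)) (w : List U) (n : ℕ) :
    b (w.map (ε ^ n : U →ₗ[k] U)) = (n : ℤ).negOnePow • (ε ^ n) (b w) := by
  induction n generalizing w with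
  | zero => simp [Module.End.one_eq_id]
  | succ n ih =>
    have : w.map (ε ^ (n + 1) : U →ₗ[k] U) = (w.map ε).map (ε ^ n : U →ₗ[k] U) := by
      simp [pow_succ]
    rw [this, ih, ← neg_eq_iff_eq_neg.2 (hb w), pow_succ]
    simp [Int.negOnePow_succ]

/-- The sign has two sources: moving `ε ^ z.length` out of the odd inner `b`, and the excess `ε ^
y.length` on `x`. The remaining power `z.length + 1` on `x` is the twist of the outer word. -/
theorem bar_term {𝒰 : ℤ → Submodule k U} {ε : U →ₗ[k] U} {b : List U → U}
    (hbm : IsMultilin k b) (hε : ∀ i, ∀ a ∈ 𝒰 i, ε a = (i + 1).negOnePow • a)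
    (hb : ∀ w, ε (b w) = -b (w.map ε)) {I : List ℤ} {x : List U}
    (h : IsHomogWord 𝒰 I x) (y z : List U) :
    b (((twist ε x).map (ε ^ (y.length + z.length) : U →ₗ[k] U)).map ε ++
        b ((twist ε y).map (ε ^ z.length : U →ₗ[k] U)) :: twist ε z) =
      ((z.length : ℤ) + y.length * (I.sum + I.length)).negOnePow •
        b (twist ε (x ++ b (twist ε y) :: z)) := by
  have hmem : ∀ i, ∀ a ∈ 𝒰 i, ε a ∈ 𝒰 i := by
    intro i a ha
    rw [hε i a ha, Units.smul_def]
    exact zsmul_mem ha _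
  have e : ((twist ε x).map (ε ^ (y.length + z.length) : U →ₗ[k] U)).map ε =
      (twist ε x).map (ε ^ (y.length + (z.length + 1)) : U →ₗ[k] U) := by
    simp [← add_assoc, pow_succ']
  have e' : (twist ε x).map (ε ^ (y.length + (z.length + 1)) : U →ₗ[k] U) =
      ((twist ε x).map (ε ^ (z.length + 1) : U →ₗ[k] U)).map (ε ^ y.length : U →ₗ[k] U) := by
    simp [pow_add]
  have hx : ∀ n, IsHomogWord 𝒰 I ((twist ε x).map (ε ^ n : U →ₗ[k] U)) := by
    intro n
    induction n with
    | zero => simpa using h.twist hmem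
    | succ n ih => simpa [pow_succ'] using ih.map hmem
  rw [e, e', map_pow_odd hb, hbm.units_smul, hbm.map_sign_pow hε (hx _), twist_append, twist,
    smul_smul, ← Int.negOnePow_add, List.length_cons]

theorem ofFn_update {α : Type*} {n : ℕ} [DecidableEq (Fin n)] (v : Fin n → α) (i : Fin n) (x : α) :
    List.ofFn (Function.update v i x) = (List.ofFn v).set i x := by
  apply List.ext_getElem
  · simp
  · intro r h₁ h₂
    simp [List.getElem_set, Function.update_apply, Fin.ext_iff, eq_comm]

/-- The `n`-linear map given by the values of `φ` on words of length `n`. -/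
def IsMultilin.toMultilinearMap {φ : List U → U} (hφ : IsMultilin k φ) (n : ℕ) :
    MultilinearMap k (fun _ : Fin n => U) U :=
  have key : ∀ [DecidableEq (Fin n)] (v : Fin n → U) (i : Fin n) (x : U),
      List.ofFn (Function.update v i x) =
        (List.ofFn v).take i ++ x :: (List.ofFn v).drop (i + 1) := by
    intro _ v i x
    rw [ofFn_update, List.set_eq_take_append_cons_drop, if_pos (by simp)]
  { toFun := fun v => φ (List.ofFn v)
    map_update_add' := fun v i x y => by simp only [key, hφ.add]
    map_update_smul' := fun v i c x => by simp only [key, hφ.smul] }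

end Twist

/-! ### Words cut out of a sequence. -/

section Sequences

/-- The word `a s, …, a (s + n - 1)`. -/
def seqWord {α : Type*} (a : ℕ → α) (s n : ℕ) : List α := List.ofFn fun t : Fin n => a (s + t)

theorem length_seqWord {α : Type*} (a : ℕ → α) (s n : ℕ) : (seqWord a s n).length = n := by
  simp [seqWord]

theorem take_seqWord {α : Type*} (a : ℕ → α) (s n i : ℕ) (h : i ≤ n) :
    (seqWord a s n).take i = seqWord a s i := by
  apply List.ext_getElem <;> simp [seqWord, h]

theorem drop_seqWord {α : Type*} (a : ℕ → α) (s n i : ℕ) :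
    (seqWord a s n).drop i = seqWord a (s + i) (n - i) := by
  apply List.ext_getElem <;> simp [seqWord, add_assoc]

theorem isHomogWord_seqWord {𝒰 : ℤ → Submodule k U} {g : ℕ → ℤ} {a : ℕ → U}
    (h : ∀ r, a r ∈ 𝒰 (g r)) (s n : ℕ) : IsHomogWord 𝒰 (seqWord g s n) (seqWord a s n) := by
  rw [IsHomogWord, List.forall₂_iff_get]
  simp [seqWord, h]

theorem sum_seqWord (g : ℕ → ℤ) (n : ℕ) : (seqWord g 0 n).sum = ∑ r ∈ Finset.range n, g r := by
  rw [seqWord, List.sum_ofFn, Finset.sum_range]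
  simp

theorem ofFn_insert {α : Type*} (a : ℕ → α) (c : α) (i j s : ℕ) (hs : s < i) (hj : 1 ≤ j) :
    (List.ofFn fun r : Fin i => if (r : ℕ) < s then a r else if (r : ℕ) = s then c
      else a (r + j - 1)) = seqWord a 0 s ++ c :: seqWord a (s + j) (i - s - 1) := by
  apply List.ext_getElem
  · simp [seqWord]; omega
  · intro r h₁ h₂
    simp only [List.getElem_ofFn, List.getElem_append, length_seqWord, List.getElem_cons]
    split_ifs with h h' h'
    · simp [seqWord]
    · rfl
    · omega
    · omega
    · simp only [seqWord, List.getElem_ofFn]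
      congr 1
      omega

end Sequences

/-! ### From a square-zero bar differential to the `A(∞)` relations. -/

section Relation

theorem transfer_singleton (ε d : U →ₗ[k] U) (m η : U →ₗ[k] U →ₗ[k] U) (a : U) :
    transfer ε d m η [a] = d a := by
  have h : treeSum η [a] = a := by
    rw [treeSum_eq]
    simp [conv, splitSum_cons, splitSum_nil, treeSum_nil, letter]
  simp [transfer, transferAux, conv, splitSum_cons, splitSum_nil, treeSum_nil, h]

theorem transfer_pair (ε d : U →ₗ[k] U) (m η : U →ₗ[k] U →ₗ[k] U) (a c : U) :
    transfer ε d m η [a, c] = m a c - d (η a c) + η (d a) c + η (ε a) (d c) := by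
  have h : ∀ a, treeSum η [a] = a := by
    intro a
    rw [treeSum_eq]
    simp [conv, splitSum_cons, splitSum_nil, treeSum_nil, letter]
  have h₂ : treeSum η [a, c] = -η a c := by
    rw [treeSum_eq]
    simp [conv, splitSum_cons, splitSum_nil, treeSum_nil, letter, h]
  simp [transfer, transferAux, conv, splitSum_cons, splitSum_nil, treeSum_nil, h, h₂]
  abel

theorem sum_antidiagonal_filter_two {M : Type*} [AddCommMonoid M] (f : ℕ × ℕ → M) (n : ℕ) :
    ∑ p ∈ (Finset.HasAntidiagonal.antidiagonal (n + 2 + 1)).filter (fun p => 2 ≤ p.1 ∧ 2 ≤ p.2),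
      f p = ∑ q ∈ Finset.range n, f (n + 1 - q, q + 2) := by
  refine Finset.sum_nbij' (fun p => p.2 - 2) (fun q => (n + 1 - q, q + 2)) ?_ ?_ ?_ ?_ ?_
  · rintro ⟨i, j⟩ h
    simp at h ⊢
    omega
  · intro q h
    simp at h ⊢
    omega
  · rintro ⟨i, j⟩ h
    simp at h ⊢
    omega
  · intro q h
    simp
  · rintro ⟨i, j⟩ h
    simp at h ⊢
    congr 2 <;> omega

theorem sum_range_sub_swap {M : Type*} [AddCommMonoid M] (T : ℕ → ℕ → M) (n : ℕ) :
    ∑ s ∈ Finset.range (n + 1), ∑ j ∈ Finset.range (n - s + 1), T s j =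
      ∑ j ∈ Finset.range (n + 1), ∑ s ∈ Finset.range (n + 1 - j), T s j :=
  Finset.sum_comm' fun s j => by simp only [Finset.mem_range]; omega

variable {𝒰 : ℤ → Submodule k U} {ε d : U →ₗ[k] U} {b : List U → U}

theorem sum_seqWord_eq_zero (hbm : IsMultilin k b)
    (hε : ∀ i, ∀ a ∈ 𝒰 i, ε a = (i + 1).negOnePow • a)
    (hb : ∀ w, ε (b w) = -b (w.map ε)) (hbb : ∀ w, coder ε b b w = 0)
    {g : ℕ → ℤ} {a : ℕ → U} (ha : ∀ r, a r ∈ 𝒰 (g r)) (n : ℕ) :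
    ∑ s ∈ Finset.range (n + 1), ∑ j ∈ Finset.range (n - s + 1),
      (((n - s - j : ℕ) : ℤ) + j * (∑ r ∈ Finset.range s, g r + s)).negOnePow •
        b (twist ε (seqWord a 0 s ++ b (twist ε (seqWord a s j)) :: seqWord a (s + j) (n - s - j)))
      = 0 := by
  rw [← hbb (twist ε (seqWord a 0 n)), coder, splitSum_twist, splitSum, length_seqWord]
  refine Finset.sum_congr rfl fun s hs => ?_
  have hs' : s ≤ n := Nat.lt_succ_iff.1 (Finset.mem_range.1 hs)
  rw [splitSum_twist, splitSum, take_seqWord a 0 n s hs', drop_seqWord, zero_add, length_seqWord]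
  refine Finset.sum_congr rfl fun j hj => ?_
  have hj' : j ≤ n - s := Nat.lt_succ_iff.1 (Finset.mem_range.1 hj)
  rw [take_seqWord a s _ j hj', drop_seqWord]
  have h := bar_term hbm hε hb (isHomogWord_seqWord ha 0 s) (seqWord a s j)
    (seqWord a (s + j) (n - s - j))
  simp only [length_seqWord, sum_seqWord] at h ⊢
  rw [← h, Nat.add_sub_cancel' hj']

/-- The relation is `coder ε b b = 0` sorted by the length `j` of the inner word: `j = 0`
contributes nothing, `j = 1` and `j = n` (the full length) form the differential of the operation,
and the other `j` give the compositions. -/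
theorem isAInfinity_of_bar (hc : IsChainComplex 𝒰 d) (hbm : IsMultilin k b)
    (hε : ∀ i, ∀ a ∈ 𝒰 i, ε a = (i + 1).negOnePow • a)
    (hb : ∀ w, ε (b w) = -b (w.map ε)) (hbb : ∀ w, coder ε b b w = 0)
    (hnil : b [] = 0) (hd : ∀ a, b [a] = d a) (hdeg : HasWordDegree 𝒰 (-2) b) :
    IsAInfinity 𝒰 d fun n => (hbm.twist ε).toMultilinearMap n := by
  have hmem : ∀ i, ∀ a ∈ 𝒰 i, ε a ∈ 𝒰 i := by
    intro i a ha
    rw [hε i a ha, Units.smul_def]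
    exact zsmul_mem ha _
  have happ : ∀ (n s : ℕ) (a : ℕ → U),
      (hbm.twist ε).toMultilinearMap n (fun r : Fin n => a (s + r)) =
        b (twist ε (seqWord a s n)) := fun n s a => rfl
  have happ₀ : ∀ (n : ℕ) (a : ℕ → U),
      (hbm.twist ε).toMultilinearMap n (fun r : Fin n => a r) =
        b (twist ε (seqWord a 0 n)) := by
    intro n a
    simp only [← happ, zero_add]
  have hins : ∀ (i j s : ℕ) (c : U) (a : ℕ → U), s < i → 1 ≤ j →
      (hbm.twist ε).toMultilinearMap i (fun r : Fin i => if (r : ℕ) < s then a r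
        else if (r : ℕ) = s then c else a (r + j - 1)) =
        b (twist ε (seqWord a 0 s ++ c :: seqWord a (s + j) (i - s - 1))) := by
    intro i j s c a hs hj
    rw [← ofFn_insert a c i j s hs hj]
    rfl
  refine ⟨hc, ?_, ?_⟩
  · intro n hn g a ha
    have := hdeg _ _ ((isHomogWord_seqWord ha 0 n).twist hmem)
    rw [happ₀]
    rw [sum_seqWord, length_seqWord] at this
    convert this using 2
    ring
  · intro n hn g a ha
    obtain ⟨n, rfl⟩ := Nat.exists_eq_add_of_le' hn
    have key := sum_seqWord_eq_zero hbm hε hb hbb ha (n + 2)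
    rw [sum_range_sub_swap (fun s j => (((n + 2 - s - j : ℕ) : ℤ) +
      j * (∑ r ∈ Finset.range s, g r + s)).negOnePow • b (twist ε (seqWord a 0 s ++
        b (twist ε (seqWord a s j)) :: seqWord a (s + j) (n + 2 - s - j)))),
      Finset.sum_range_succ', Finset.sum_range_succ', Finset.sum_range_succ] at key
    have h₀ : ∀ s, b (twist ε (seqWord a s 0)) = 0 := fun s => hnil
    have h₁ : ∀ s, b (twist ε (seqWord a s 1)) = d (a s) := fun s => by
      simp [seqWord, twist, hd]
    rw [sum_antidiagonal_filter_two]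
    have hA : ∑ s ∈ Finset.range (n + 2 + 1 - (n + 1 + 1)),
        (((n + 2 - s - (n + 1 + 1) : ℕ) : ℤ) +
          ((n + 1 + 1 : ℕ) : ℤ) * (∑ r ∈ Finset.range s, g r + s)).negOnePow •
          b (twist ε (seqWord a 0 s ++ b (twist ε (seqWord a s (n + 1 + 1))) ::
            seqWord a (s + (n + 1 + 1)) (n + 2 - s - (n + 1 + 1)))) =
        d (b (twist ε (seqWord a 0 (n + 2)))) := by
      have hn' : n + 2 + 1 - (n + 1 + 1) = 1 := by omega
      rw [hn', Finset.sum_range_one, ← hd]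
      simp [seqWord, twist]
    have hB : ∑ s ∈ Finset.range (n + 2 + 1 - (0 + 1)),
        (((n + 2 - s - (0 + 1) : ℕ) : ℤ) +
          ((0 + 1 : ℕ) : ℤ) * (∑ r ∈ Finset.range s, g r + s)).negOnePow •
          b (twist ε (seqWord a 0 s ++ b (twist ε (seqWord a s (0 + 1))) ::
            seqWord a (s + (0 + 1)) (n + 2 - s - (0 + 1)))) =
        -(((n + 2 : ℕ) : ℤ) - 2).negOnePow • ∑ s ∈ Finset.range (n + 2),
          (∑ r ∈ Finset.range s, g r).negOnePow •
            (hbm.twist ε).toMultilinearMap (n + 2)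
              (fun r : Fin (n + 2) => if (r : ℕ) = s then d (a r) else a r) := by
      rw [Finset.smul_sum]
      refine Finset.sum_congr rfl fun s hs => ?_
      have hs' : s < n + 2 := Finset.mem_range.1 hs
      have e : (fun r : Fin (n + 2) => if (r : ℕ) = s then d (a r) else a r) =
          fun r : Fin (n + 2) => if (r : ℕ) < s then a r
            else if (r : ℕ) = s then d (a s) else a (r + 1 - 1) := by
        funext r
        split_ifs with h h' h'
        · omega
        · rw [h]
        · rfl
        · rfl
      rw [e, hins _ _ _ _ _ hs' le_rfl, zero_add, h₁, smul_smul, Nat.sub_right_comm,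
        ← Int.negOnePow_succ, ← Int.negOnePow_add]
      congr 1
      rw [Int.negOnePow_eq_iff, Nat.cast_sub (by omega), Nat.cast_sub (by omega)]
      push_cast
      exact ⟨0, by ring⟩
    have hS : ∑ q ∈ Finset.range n, ∑ s ∈ Finset.range (n + 2 + 1 - (q + 1 + 1)),
        (((n + 2 - s - (q + 1 + 1) : ℕ) : ℤ) +
          ((q + 1 + 1 : ℕ) : ℤ) * (∑ r ∈ Finset.range s, g r + s)).negOnePow •
          b (twist ε (seqWord a 0 s ++ b (twist ε (seqWord a s (q + 1 + 1))) ::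
            seqWord a (s + (q + 1 + 1)) (n + 2 - s - (q + 1 + 1)))) =
        -∑ q ∈ Finset.range n, ∑ s ∈ Finset.range (n + 1 - q),
          (((n + 1 - q : ℕ) : ℤ) + s * (((q + 2 : ℕ) : ℤ) + 1)).negOnePow •
            insertOp ((hbm.twist ε).toMultilinearMap (n + 1 - q)) (((q + 2 : ℕ) : ℤ) - 2)
              ((hbm.twist ε).toMultilinearMap (q + 2)) s g a := by
      rw [← Finset.sum_neg_distrib]
      refine Finset.sum_congr rfl fun q hq => ?_
      rw [← Finset.sum_neg_distrib]
      have hq' : q < n := Finset.mem_range.1 hq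
      have hr : n + 2 + 1 - (q + 1 + 1) = n + 1 - q := by omega
      rw [hr]
      refine Finset.sum_congr rfl fun s hs => ?_
      have hs' : s < n + 1 - q := Finset.mem_range.1 hs
      have hl : n + 2 - s - (q + 1 + 1) = n + 1 - q - s - 1 := by omega
      rw [insertOp, happ, hins _ _ _ _ _ hs' (by omega), hl, smul_smul, ← Int.negOnePow_add,
        ← Units.neg_smul, ← Int.negOnePow_succ]
      congr 1
      rw [Int.negOnePow_eq_iff, Nat.cast_sub (by omega), Nat.cast_sub (by omega),
        Nat.cast_sub (by omega)]
      push_cast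
      -- Half the difference of the exponents; the Koszul sign uses the degree `q` of the inner
      -- operation in place of its arity `q + 2`.
      exact ⟨∑ r ∈ Finset.range s, g r - s - 1, by ring⟩
    have hC : ∑ s ∈ Finset.range (n + 2 + 1 - 0),
        (((n + 2 - s - 0 : ℕ) : ℤ) +
          ((0 : ℕ) : ℤ) * (∑ r ∈ Finset.range s, g r + s)).negOnePow •
          b (twist ε (seqWord a 0 s ++ b (twist ε (seqWord a s 0)) ::
            seqWord a (s + 0) (n + 2 - s - 0))) = 0 :=
      Finset.sum_eq_zero fun s _ => by rw [h₀, (hbm.twist ε).zero, smul_zero]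
    rw [hA, hB, hS, hC, add_zero, Units.neg_smul] at key
    rw [homDiff, happ₀, ← sub_eq_zero, ← key]
    abel

end Relation

/-! ### The grading involution of the suspension. -/

section Involution

variable {𝒰 : ℤ → Submodule k U}

theorem homog_induction (h : DirectSum.IsInternal 𝒰) {P : U → Prop}
    (mem : ∀ i, ∀ a ∈ 𝒰 i, P a) (add : ∀ a b, P a → P b → P (a + b)) (a : U) : P a :=
  Submodule.iSup_induction 𝒰 (motive := P)
    (h.submodule_iSup_eq_top ▸ Submodule.mem_top : a ∈ ⨆ i, 𝒰 i) mem (mem 0 0 (zero_mem _)) add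

theorem exists_sign (h : DirectSum.IsInternal 𝒰) :
    ∃ ε : U →ₗ[k] U, ∀ i, ∀ a ∈ 𝒰 i, ε a = (i + 1).negOnePow • a := by
  let e := LinearEquiv.ofBijective (DirectSum.coeLinearMap 𝒰) h
  refine ⟨DirectSum.toModule k ℤ U
    (fun i => ((i + 1).negOnePow : ℤ) • (𝒰 i).subtype) ∘ₗ e.symm.toLinearMap, fun i a ha => ?_⟩
  have : e.symm a = DirectSum.lof k ℤ (fun i => 𝒰 i) i ⟨a, ha⟩ := by
    rw [LinearEquiv.symm_apply_eq]
    exact (DirectSum.coeLinearMap_lof 𝒰 i ⟨a, ha⟩).symm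
  simp [this, Units.smul_def]

end Involution

end HomotopyAlg

theorem mainTheorem5 {k : Type*} [Field k] [CharZero k] {U : Type*} [AddCommGroup U] [Module k U]
    (𝒰 : ℤ → Submodule k U) (d : U →ₗ[k] U) (μ ν : U →ₗ[k] U →ₗ[k] U)
    (hμ : HomotopyAlg.IsDGAssociative 𝒰 d μ)
    (hν : HomotopyAlg.ChainHomotopic 𝒰 d ν μ) :
    ∃ m : (n : ℕ) → MultilinearMap k (fun _ : Fin n => U) U,
      HomotopyAlg.IsAInfinity 𝒰 d m ∧ ∀ a b : U, m 2 ![a, b] = ν a b := by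
  obtain ⟨h, hdeg, hh⟩ := hν
  have hint := hμ.complex.internal
  obtain ⟨ε, hε⟩ := HomotopyAlg.exists_sign hint
  have hsmul : ∀ (f : U →ₗ[k] U) (u : ℤˣ) (a : U), f (u • a) = u • f a := fun f u a => by
    rw [Units.smul_def, map_zsmul, Units.smul_def]
  have hsmul₂ : ∀ (f : U →ₗ[k] U →ₗ[k] U) (u : ℤˣ) (a b : U), f (u • a) b = u • f a b :=
    fun f u a b => hsmul (f.flip b) u a
  have hmem : ∀ i, ∀ a ∈ 𝒰 i, ε a ∈ 𝒰 i := by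
    intro i a ha
    rw [hε i a ha, Units.smul_def]
    exact zsmul_mem ha _
  have hinv : ∀ a, ε (ε a) = a := fun a => by
    induction a using HomotopyAlg.homog_induction hint with
    | mem i a ha => rw [hε i a ha, hsmul, hε i a ha, smul_smul, Int.units_mul_self, one_smul]
    | add a b ha hb => simp [ha, hb]
  have hd : ∀ a, ε (d a) = -d (ε a) := fun a => by
    induction a using HomotopyAlg.homog_induction hint with
    | mem i a ha =>
      rw [hε _ _ (hμ.complex.degree i a ha), hε i a ha, hsmul, sub_add_cancel, Int.negOnePow_succ,
        Units.neg_smul, neg_neg]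
    | add a b ha hb => simp [ha, hb]; abel
  have hm : ∀ a b, ε (μ a b) = -μ (ε a) (ε b) := fun a b => by
    induction a using HomotopyAlg.homog_induction hint with
    | mem i a ha =>
      induction b using HomotopyAlg.homog_induction hint with
      | mem j b hb =>
        rw [hε _ _ (hμ.degree i j a b ha hb), hε i a ha, hε j b hb, hsmul, hsmul₂, smul_smul,
          ← Int.negOnePow_add, ← Units.neg_smul, ← Int.negOnePow_succ]
        congr 1
        rw [Int.negOnePow_eq_iff]
        exact ⟨-1, by ring⟩
      | add b c hb hc => simp [hb, hc]; abel
    | add a c ha hc => simp [ha, hc]; abel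
  have hη : ∀ a b, ε (h a b) = h (ε a) (ε b) := fun a b => by
    induction a using HomotopyAlg.homog_induction hint with
    | mem i a ha =>
      induction b using HomotopyAlg.homog_induction hint with
      | mem j b hb =>
        rw [hε _ _ (hdeg i j a b ha hb), hε i a ha, hε j b hb, hsmul, hsmul₂, smul_smul,
          ← Int.negOnePow_add]
        congr 2
        ring
      | add b c hb hc => simp [hb, hc]
    | add a c ha hc => simp [ha, hc]
  have hleib : ∀ a b, d (μ a b) = μ (d a) b - μ (ε a) (d b) := fun a b => by
    induction a using HomotopyAlg.homog_induction hint with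
    | mem i a ha =>
      rw [hμ.leibniz i a b ha, hε i a ha, hsmul₂, Int.negOnePow_succ, Units.neg_smul, sub_neg_eq_add]
    | add a c ha hc => simp [ha, hc]; abel
  have hhom : ∀ a b, ν a b = μ a b + d (h a b) + h (d a) b - h (ε a) (d b) := fun a b => by
    induction a using HomotopyAlg.homog_induction hint with
    | mem i a ha =>
      rw [hε i a ha, hsmul₂, Int.negOnePow_succ, Units.neg_smul, sub_neg_eq_add,
        ← sub_add_cancel (ν a b) (μ a b), hh i a b ha]
      abel
    | add a c ha hc => simp [ha, hc]; abel
  -- Precomposing the first argument with `ε` is the suspension sign; the minus sign on `h` makes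
  -- the binary operation `ν`, since `d η` enters `transfer_pair` negatively.
  have H : HomotopyAlg.BarData ε d (μ ∘ₗ ε) (-(h ∘ₗ ε)) :=
    { odd_d := hd
      odd_m := fun a b => by simp [hm]
      even_η := fun a b => by simp [hη]
      square := hμ.complex.square
      leibniz := fun a b => by simp [hleib, hd, hinv]; abel
      assoc := fun a b c => by simp [hm, hinv, hμ.assoc] }
  have hbm := HomotopyAlg.isMultilin_transfer ε d (μ ∘ₗ ε) (-(h ∘ₗ ε))
  refine ⟨fun n => (hbm.twist ε).toMultilinearMap n, ?_, fun a b => ?_⟩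
  · refine HomotopyAlg.isAInfinity_of_bar hμ.complex hbm hε H.map_transfer
      H.coder_transfer_transfer (HomotopyAlg.transfer_nil ..)
      (HomotopyAlg.transfer_singleton _ _ _ _) (HomotopyAlg.hasWordDegree_transfer hmem
        hμ.complex.degree ?_ ?_)
    · exact fun i j a b ha hb => hμ.degree i j _ _ (hmem i a ha) hb
    · exact fun i j a b ha hb => neg_mem (hdeg i j _ _ (hmem i a ha) hb)
  -- The twist puts one `ε` on `a`, which cancels the `ε` built into `μ ∘ₗ ε` and `h ∘ₗ ε`.
  · change HomotopyAlg.transfer ε d (μ ∘ₗ ε) (-(h ∘ₗ ε)) [(ε ^ 1) a, b] = ν a b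
    rw [HomotopyAlg.transfer_pair, hhom]
    simp [hinv, hd]
    abel
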